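/- **Labeled graphs.** Let $a,b$ freely generate a free group. We consider graphs whose oriented edges are labeled by $a^{\pm1},b^{\pm1}$ so that inverse edges carry inverse labels. Such a labeling is *reduced* if no two distinct edges with the same label start at the same vertex. *Folding* a labeled graph means identifying, as long as possible, two edges with the same label and the same initial vertex (together with their terminal vertices); the result $\overline{\Omega}$ is the *folded graph* of $\Omega$. Subgraphs of labeled graphs are understood to carry the same labels. **Generalized Rips–Segev graphs.** Let $K\ge 1$ and $C_1,\dots,C_K\ge 1$ be integers. For each $1\le i\le K$ take the "$a$-line" with vertices $v_{i0},\dots,v_{iC_i}$ and an $a$-edge from $v_{i(l-1)}$ to $v_{il}$ for $1\le l\le C_i$, and for each $0\le l\le C_i$ add a $b$-edge from $v_{il}$ to a new vertex $w_{il}$. 1. Identify each of the $2K$ vertices $w_{i0},w_{iC_i}$ with some vertex $v_{jI}$, $0\le I\le C_j$, the pairs $(j,I)$ being pairwise distinct. 2. Identify each vertex $v_{j0}$ or $v_{jC_j}$ that was not identified with any $w$ in step 1 with some $w_{lO}$, $0<O<C_l$, the pairs $(l,O)$ being pairwise distinct. The choices are made so that the resulting graph is connected. 3. Delete the $b$-edges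 whose terminal vertex has not been identified with any $v$. The resulting graph $\Theta'$ is a *generalized Rips–Segev graph* (with given coefficients). Moreover, if $c_1,\dots,c_K$ are reduced words in $a^{\pm1},b^{\pm1}$ such that the elements $c_ia^l$ ($1\le i\le K$, $0\le l<C_i$) are pairwise distinct in the free group, attach to $\Theta'$ for each $i$ a path labeled $c_i$ that ends at $v_{i0}$, identify the starting vertices of these $K$ paths, and fold; the resulting graph is also a *generalized Rips–Segev graph* (for $A=\{c_ia^l\}$ and $B=\{1,a,b,ab\}$). **Random labelings.** For a finite graph $\Delta$ let $\Delta^j$ be its $j$-subdivision, obtained by replacing each edge with $j$ edges. In a *random labeling* of $\Delta^j$ the edges are labeled independently and uniformly by $a^{\pm1},b^{\pm1}$; let $\overline{\Delta^j}$ be the folded graph so obtained. **Theorem.** For every $v\in\mathbb N$ and every real $C\ge 1$ there is an integer $j_0$ such that for every $j\ge j_0$ there are constants $M$ and $c>0$ with the following property. Let $(\Delta_i)_i$ be a family of finite connected simple graphs such that $\Delta_i$ has (finite) girth $\delta_i$, all vertices of $\Delta_i$ have valency at most $v$, and $\operatorname{diam}(\Delta_i)\le C\delta_i$ for all $i$.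 Then for every $i$, with probability at least $1-Me^{-c\delta_i}$, the folded graph $\overline{\Delta_i^{\,j}}$ obtained by a random labeling of $\Delta_i^{\,j}$ contains no generalized Rips–Segev graph as a subgraph. In particular, this probability tends to $1$ exponentially fast as $\delta_i\to\infty$. -/

import Mathlib

namespace RipsSegev

/-- The two generators `a` and `b`. A letter `a`, `a⁻¹`, `b`, `b⁻¹` is an element of `Gen × Bool`,
`(g, true)` standing for `g` and `(g, false)` for `g⁻¹`, as in `FreeGroup Gen`. -/
inductive Gen where
  | a
  | b

/-! ### Graphs labeled by `a`, `a⁻¹`, `b`, `b⁻¹` -/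

/-- A graph with vertex set `V` labeled by `{a, a⁻¹, b, b⁻¹}`. `edge g x y` says that there is an
edge from `x` to `y` labeled `g`; traversed from `y` to `x`, the same edge is labeled `g⁻¹`. -/
structure LabeledGraph (V : Type*) where
  edge : Gen → V → V → Prop

namespace LabeledGraph

variable {V W : Type*}

/-- `Γ` is (isomorphic to) a labeled subgraph of `Ω`. An edge is determined by its label and its
ends, so that injectivity on edges follows from injectivity on vertices. -/
def IsSubgraphOf (Γ : LabeledGraph V) (Ω : LabeledGraph W) : Prop :=
  ∃ φ : V → W, Function.Injective φ ∧ ∀ g x y, Γ.edge g x y → Ω.edge g (φ x) (φ y)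

/-- Any two vertices are joined by a path of edges, traversed in either direction. -/
def Connected (Ω : LabeledGraph V) : Prop :=
  ∀ x y, Relation.EqvGen (fun x y => ∃ g, Ω.edge g x y) x y

/-- The labeled graph obtained by identifying vertices along `r` (that is, along the equivalence
relation generated by `r`). -/
def quot (Ω : LabeledGraph V) (r : V → V → Prop) : LabeledGraph (Quot r) where
  edge g X Y := ∃ x y, Quot.mk r x = X ∧ Quot.mk r y = Y ∧ Ω.edge g x y

/-- The vertices that get identified by folding: whenever two edges with the same label start at
identified vertices, their terminal vertices are identified, and likewise with all edges
reversed. -/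
inductive FoldRel (Ω : LabeledGraph V) : V → V → Prop
  | refl (x) : FoldRel Ω x x
  | symm {x y} : FoldRel Ω x y → FoldRel Ω y x
  | trans {x y z} : FoldRel Ω x y → FoldRel Ω y z → FoldRel Ω x z
  | out {g x y x' y'} : FoldRel Ω x y → Ω.edge g x x' → Ω.edge g y y' → FoldRel Ω x' y'
  | into {g x y x' y'} : FoldRel Ω x y → Ω.edge g x' x → Ω.edge g y' y → FoldRel Ω x' y'

/-- The folded (reduced) graph: the result of folding until the labeling is reduced. -/
def fold (Ω : LabeledGraph V) : LabeledGraph (Quot Ω.FoldRel) :=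
  Ω.quot Ω.FoldRel

end LabeledGraph

/-! ### Generalized Rips-Segev graphs -/

/-- The choices made in the construction of a generalized Rips-Segev graph. There are `K` many
`a`-lines, the `i`-th one with vertices `v i 0, …, v i (C i)`; the pair `⟨i, l⟩` stands for
`v i l`. At `v i l` there starts a `b`-edge with terminal vertex `w i l`. -/
structure Coefficients where
  K : ℕ
  K_pos : 0 < K
  C : Fin K → ℕ
  C_pos : ∀ i, 0 < C i
  /-- First step: `w i 0` is identified with `step1 (i, false)`, and `w i (C i)` with
  `step1 (i, true)`. -/
  step1 : Fin K × Bool → (Σ i : Fin K, Fin (C i + 1))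
  step1_injective : Function.Injective step1
  /-- Second step: an end `v` of an `a`-line (`v i 0` for `(i, false)`, `v i (C i)` for
  `(i, true)`) that has not been identified in the first step is identified with `w l O`,
  where `⟨l, O⟩` is the value of `step2`. -/
  step2 : {e : Fin K × Bool // ∀ e', step1 e' ≠ ⟨e.1, if e.2 then Fin.last _ else 0⟩} →
    (Σ i : Fin K, Fin (C i + 1))
  step2_injective : Function.Injective step2
  step2_pos : ∀ e, 0 < ((step2 e).2 : ℕ)
  step2_lt : ∀ e, ((step2 e).2 : ℕ) < C (step2 e).1

namespace Coefficients

variable (D : Coefficients)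

/-- The vertices `v i l`, for `0 ≤ l ≤ C i`. -/
abbrev Vertex : Type := Σ i : Fin D.K, Fin (D.C i + 1)

/-- The ends of the `a`-lines: `v i 0` for `(i, false)` and `v i (C i)` for `(i, true)`. -/
def lineEnd (e : Fin D.K × Bool) : D.Vertex := ⟨e.1, if e.2 then Fin.last _ else 0⟩

/-- The graph obtained after the first two steps and the deletion of the `b`-edges that have not
been glued. Its edges are the `a`-edges of the `a`-lines, and the `b`-edges glued in the first and
in the second step. -/
def graph : LabeledGraph D.Vertex where
  edge
    | .a, x, y => x.1 = y.1 ∧ (x.2 : ℕ) + 1 = y.2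
    | .b, x, y => (∃ e, x = D.lineEnd e ∧ y = D.step1 e) ∨ (∃ e, x = D.step2 e ∧ y = D.lineEnd e.1)

variable (c : Fin D.K → List (Gen × Bool))

/-- The conditions on the words `c i`: they are reduced, and the elements `c i * a ^ l`,
`0 ≤ l < C i`, which make up the set `A`, are pairwise distinct in the free group. -/
def Admissible : Prop :=
  (∀ i, FreeGroup.IsReduced (c i)) ∧
    Function.Injective fun x : (Σ i : Fin D.K, Fin (D.C i)) =>
      FreeGroup.mk (c x.1) * FreeGroup.of Gen.a ^ (x.2 : ℕ)

/-- The disjoint union of `D.graph` with paths `p i` that are labeled by the words `c i`. -/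
def withPaths : LabeledGraph (D.Vertex ⊕ (Σ i : Fin D.K, Fin ((c i).length + 1))) where
  edge g
    | .inl x, .inl y => D.graph.edge g x y
    | .inr ⟨i, k⟩, .inr ⟨i', k'⟩ => i = i' ∧
        (((k : ℕ) + 1 = k' ∧ (c i)[(k : ℕ)]? = some (g, true)) ∨
          ((k' : ℕ) + 1 = k ∧ (c i)[(k' : ℕ)]? = some (g, false)))
    | _, _ => False

/-- The terminal vertex of `p i` is glued to `v i 0`, and the starting vertices of all the `p i`
are identified. -/
inductive Glue : D.Vertex ⊕ (Σ i : Fin D.K, Fin ((c i).length + 1)) →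
    D.Vertex ⊕ (Σ i : Fin D.K, Fin ((c i).length + 1)) → Prop
  | terminal (i) : Glue (.inr ⟨i, Fin.last _⟩) (.inl ⟨i, 0⟩)
  | start (i i') : Glue (.inr ⟨i, 0⟩) (.inr ⟨i', 0⟩)

/-- The graph obtained from `D.graph` by attaching the paths `p i` and folding. -/
def graphFor : LabeledGraph (Quot ((D.withPaths c).quot (D.Glue c)).FoldRel) :=
  ((D.withPaths c).quot (D.Glue c)).fold

end Coefficients

/-- `Ω` contains a generalized Rips-Segev graph as a subgraph: either one with given coefficients,
or one for the sets `A = {c i * a ^ l | 0 ≤ l < C i}` and `B = {1, a, b, ab}`. -/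
def ContainsRipsSegev {V : Type*} (Ω : LabeledGraph V) : Prop :=
  ∃ D : Coefficients, D.graph.Connected ∧
    (D.graph.IsSubgraphOf Ω ∨ ∃ c, D.Admissible c ∧ (D.graphFor c).IsSubgraphOf Ω)

/-! ### Subdivisions and random labelings -/

section Random

variable {V : Type*}

/-- The point at distance `k` from `u` on the edge from `u` to `w`, each edge having length `j`.
It is encoded by its barycentric coordinates (times `j`), that is, as the multiset
with `j - k` copies of `u` and `k` copies of `w`. -/
def pt (j : ℕ) (u w : V) (k : ℕ) : Multiset V :=
  Multiset.replicate (j - k) u + Multiset.replicate k w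

/-- The vertices of the `j`-subdivision: the vertices `u` of `Δ`, encoded as `pt j u u 0`, and the
points that cut the edges of `Δ` into `j` parts. -/
def SubdivVertex (Δ : SimpleGraph V) (j : ℕ) : Type _ :=
  {m : Multiset V // (∃ u, m = pt j u u 0) ∨ ∃ u w k, Δ.Adj u w ∧ k ≤ j ∧ m = pt j u w k}

/-- The `j`-subdivision of `Δ`, in which each edge of `Δ` is replaced with `j` edges. -/
def subdivision (Δ : SimpleGraph V) (j : ℕ) : SimpleGraph (SubdivVertex Δ j) where
  Adj x y := ∃ u w k, Δ.Adj u w ∧ k < j ∧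
    ((x.1 = pt j u w k ∧ y.1 = pt j u w (k + 1)) ∨ (y.1 = pt j u w k ∧ x.1 = pt j u w (k + 1)))
  symm := ⟨fun _ _ ⟨u, w, k, h, hk, hxy⟩ => ⟨u, w, k, h, hk, hxy.symm⟩⟩
  loopless := ⟨fun x ⟨u, w, k, h, hk, hx⟩ => by
    classical
    have key : pt j u w k ≠ pt j u w (k + 1) := fun e => by
      have := congrArg (Multiset.count w) e
      simp [pt, Multiset.count_replicate, h.ne] at this
    rcases hx with ⟨h1, h2⟩ | ⟨h1, h2⟩ <;> exact key (h1.symm.trans h2)⟩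

/-- The labelings `ω` of the oriented edges of `G` by `a`, `a⁻¹`, `b`, `b⁻¹`, with
`ω (e⁻¹) = (ω e)⁻¹`. -/
def Labeling (G : SimpleGraph V) : Type _ :=
  {ω : G.Dart → Gen × Bool // ∀ d, ω d.symm = ((ω d).1, !(ω d).2)}

/-- The labeled graph given by a labeling of `G`. -/
def Labeling.toLabeledGraph {G : SimpleGraph V} (ω : Labeling G) : LabeledGraph V where
  edge g x y := ∃ h : G.Adj x y, ω.1 ⟨(x, y), h⟩ = (g, true)

/-- The probability that a uniformly random labeling of the finite graph `G` has the property `P`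
(so that the labels of distinct unoriented edges are independent and uniformly distributed
among the four letters). -/
noncomputable def labelingProb (G : SimpleGraph V) (P : Labeling G → Prop) : ℝ :=
  (Nat.card {ω : Labeling G // P ω} : ℝ) / Nat.card (Labeling G)

end Random

end RipsSegev

namespace RipsSegev

/-! Let `L` be a small multiple of the girth `δ`, with `4 * L` below the girth of the subdivision,
and let `B` be such that `2 ^ B` exceeds its number of vertices. Bounded valency and `diam ≤ C * δ`
allow `B` to be linear in `δ`.

Along a fixed path the label is a simple random walk in the free group, and its number of letters
`b` grows linearly except with exponentially small probability (`sum_weight_letter_mul_le`,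
`Labeling.card_bCount_le`). For large `j` this beats the union bound over pairs of vertices. So
almost every labeling is spread: labels of paths of length in `[L, 2 * L]` have more than `B`
letters `b` (`Labeling.card_not_isSpread_le`).

Let a labeling be spread. A walk of length at most `2 * L` whose label has at most `B` letters `b`
can then be shortened below `L`, so a path in the folded graph lifts to a short walk as long as its
label has few letters `b`, however many letters `a` occur. In a Rips–Segev graph, from any vertex
one can go to either end of the `a`-line and cross a `b`-edge there. Repeating this `B` times gives
`2 ^ B` paths with distinct labels (`Coefficients.pathLabel_injective`). Short closed walks have
trivial label, so these paths end at distinct vertices, which are too many (`two_pow_le_card`). -/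

instance : DecidableEq Gen := fun x y => by
  cases x <;> cases y <;> first | exact isTrue rfl | exact isFalse nofun

instance : Fintype Gen := ⟨{.a, .b}, fun x => by cases x <;> simp⟩

theorem sum_letter (f : Gen × Bool → ℝ) :
    ∑ l, f l = f (.a, true) + f (.a, false) + f (.b, true) + f (.b, false) := by
  have : (Finset.univ : Finset Gen) = {.a, .b} := rfl
  rw [Fintype.sum_prod_type, this, Finset.sum_pair (by simp)]
  simp only [Fintype.sum_bool]
  ring

/-! ### Counting the letters `b` in elements of the free group -/

/-- The number of letters `b` and `b⁻¹` in the reduced word that represents `γ`. -/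
def bCount (γ : FreeGroup Gen) : ℕ := γ.toWord.countP (fun l => l.1 = .b)

theorem bCount_one : bCount 1 = 0 := by simp [bCount]

theorem bCount_mul_le (γ γ' : FreeGroup Gen) : bCount (γ * γ') ≤ bCount γ + bCount γ' := by
  unfold bCount
  rw [← List.countP_append]
  exact (FreeGroup.toWord_mul_sublist γ γ').countP_le

theorem bCount_a : bCount (FreeGroup.of .a) = 0 := by simp [bCount]

theorem bCount_a_inv : bCount (FreeGroup.of .a)⁻¹ = 0 := by
  simp [bCount, FreeGroup.toWord_inv, FreeGroup.invRev]

theorem bCount_b : bCount (FreeGroup.of .b) = 1 := by simp [bCount]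

/-- A weight on words that decays exponentially in the number of letters `b`. -/
noncomputable def wordWeight (w : List (Gen × Bool)) : ℝ :=
  (3 / 5) ^ w.countP (fun l => l.1 = .b) * if w.head?.map Prod.fst = some .b then 13 / 10 else 1

theorem le_wordWeight (w : List (Gen × Bool)) :
    (3 / 5) ^ w.countP (fun l => l.1 = .b) ≤ wordWeight w := by
  have : (0 : ℝ) < (3 / 5) ^ w.countP (fun l => l.1 = .b) := by positivity
  unfold wordWeight
  split_ifs <;> linarith

theorem wordWeight_le (w : List (Gen × Bool)) :
    wordWeight w ≤ (3 / 5) ^ w.countP (fun l => l.1 = .b) * (13 / 10) := by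
  have : (0 : ℝ) < (3 / 5) ^ w.countP (fun l => l.1 = .b) := by positivity
  unfold wordWeight
  split_ifs <;> linarith

/-- The weight of an element of the free group. -/
noncomputable def weight (γ : FreeGroup Gen) : ℝ := wordWeight γ.toWord

theorem weight_one : weight 1 = 1 := by simp [weight, wordWeight]

theorem weight_nonneg (γ : FreeGroup Gen) : 0 ≤ weight γ :=
  le_trans (by positivity) (le_wordWeight _)

theorem pow_le_weight {γ : FreeGroup Gen} {B : ℕ} (h : bCount γ ≤ B) :
    (3 / 5) ^ B ≤ weight γ :=
  (pow_le_pow_of_le_one (by norm_num) (by norm_num) h).trans (le_wordWeight _)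

/-- On average, the weight drops by a definite factor in each step of the simple random walk. -/
theorem sum_weight_letter_mul_le (γ : FreeGroup Gen) :
    ∑ l, weight (FreeGroup.mk [l] * γ) ≤ 4 * (97 / 100) * weight γ := by
  have key (l) : (FreeGroup.mk [l] * γ).toWord = FreeGroup.reduce (l :: γ.toWord) := by
    rw [FreeGroup.toWord_mul, FreeGroup.toWord_mk, FreeGroup.reduce_singleton]
    rfl
  simp only [weight, key, FreeGroup.reduce.cons, FreeGroup.reduce_toWord, sum_letter]
  rcases γ.toWord with _ | ⟨⟨g, s⟩, tl⟩
  · simp [wordWeight]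
    norm_num
  -- The weight `(3 / 5) ^ #b` alone would fail when the first letter is `b^±1`: `3/5 + 5/3 + 2 >
  -- 4`. The factor `13 / 10` on such words makes up for this, and the other words have enough slack
  -- to bear it.
  · have h1 := wordWeight_le tl
    have h2 : (0 : ℝ) < (3 / 5) ^ tl.countP (fun l => l.1 = .b) := by positivity
    cases g <;> cases s <;>
    · simp [wordWeight, pow_succ] at h1 ⊢
      linarith

end RipsSegev

namespace RipsSegev

open SimpleGraph

/-! ### Labels of walks shorter than the girth -/

section Walks

variable {V : Type*} {G : SimpleGraph V}

/-- The element of the free group that is read along a walk. -/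
def Labeling.walkLabel (ω : Labeling G) : {x y : V} → G.Walk x y → FreeGroup Gen
  | _, _, .nil => 1
  | _, _, .cons h p => FreeGroup.mk [ω.1 ⟨(_, _), h⟩] * ω.walkLabel p

namespace Labeling

variable (ω : Labeling G)

theorem mk_symm_mul_mk {x y : V} (h : G.Adj x y) :
    FreeGroup.mk [ω.1 ⟨(y, x), h.symm⟩] * FreeGroup.mk [ω.1 ⟨(x, y), h⟩] = 1 := by
  have : ω.1 ⟨(y, x), h.symm⟩ = _ := ω.2 ⟨(x, y), h⟩
  rw [this, mul_eq_one_iff_eq_inv, FreeGroup.inv_mk]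
  rfl

theorem walkLabel_append {x y z : V} (p : G.Walk x y) (q : G.Walk y z) :
    ω.walkLabel (p.append q) = ω.walkLabel p * ω.walkLabel q := by
  induction p with
  | nil => simp [walkLabel]
  | cons h p ih => simp only [Walk.cons_append, walkLabel, ih, mul_assoc]

theorem walkLabel_reverse {x y : V} (p : G.Walk x y) :
    ω.walkLabel p.reverse = (ω.walkLabel p)⁻¹ := by
  induction p with
  | nil => simp [walkLabel]
  | cons h p ih =>
    simp only [Walk.reverse_cons, walkLabel_append, walkLabel, ih, mul_inv_rev, mul_one]
    rw [eq_inv_of_mul_eq_one_left (ω.mk_symm_mul_mk h)]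

theorem walkLabel_toWalk {g : Gen} {x y : V} (h : ω.toLabeledGraph.edge g x y) :
    ω.walkLabel (Walk.cons h.1 .nil) = FreeGroup.of g := by
  obtain ⟨h, hg⟩ := h
  simp only [walkLabel, hg, mul_one]
  rfl

end Labeling

theorem path_eq_of_mem_edges {u w : V} (h : G.Adj u w) {p : G.Walk w u} (hp : p.IsPath)
    (he : s(u, w) ∈ p.edges) : p = Walk.cons h.symm .nil := by
  cases p with
  | nil => exact absurd rfl h.ne
  | @cons _ x _ h' q =>
    rw [Walk.cons_isPath_iff] at hp
    rw [Walk.edges_cons, List.mem_cons] at he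
    rcases he with he | he
    · have : u = x := by
        rcases Sym2.eq_iff.1 he with ⟨h1, -⟩ | ⟨h1, -⟩
        · exact absurd h1 h.ne
        · exact h1
      subst this
      rw [(Walk.isPath_iff_nil.1 hp.1).eq_nil]
    · exact absurd (q.snd_mem_support_of_mem_edges he) hp.2

/-- Below the girth, the loops cut out are backtracks: a path from `w` back to `u` that avoids the
edge `uw` would close up to a short cycle, so it is that edge, and the two letters cancel. -/
theorem Labeling.walkLabel_bypass [DecidableEq V] (ω : Labeling G) {x y : V} (p : G.Walk x y)
    (hp : (p.length : ℕ∞) < G.egirth) : ω.walkLabel p.bypass = ω.walkLabel p := by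
  induction p with
  | nil => rfl
  | @cons u w z h p ih =>
    have hlt : (p.length : ℕ∞) < G.egirth :=
      lt_of_le_of_lt (by simp) hp
    specialize ih hlt
    simp only [Walk.bypass]
    split_ifs with hs
    · conv_rhs => rw [walkLabel, ← ih, ← p.bypass.take_spec hs, walkLabel_append, ← mul_assoc]
      have hq := p.bypass_isPath.takeUntil hs
      have hl := (p.bypass.length_takeUntil_le_length hs).trans p.length_bypass_le_length
      generalize p.bypass.takeUntil u hs = q at hq hl
      have he : s(u, w) ∈ q.edges := by
        by_contra he
        have := egirth_le_length ((Walk.cons_isCycle_iff q h).2 ⟨hq, he⟩)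
        refine absurd (this.trans ?_) (not_le.2 hp)
        simp only [Walk.length_cons]
        exact_mod_cast Nat.succ_le_succ hl
      rw [path_eq_of_mem_edges h hq he]
      simp only [walkLabel, mul_one]
      rw [ω.mk_symm_mul_mk h.symm, one_mul]
    · simp only [walkLabel, ih]

theorem Labeling.walkLabel_eq_one (ω : Labeling G) {x : V} (p : G.Walk x x)
    (hp : (p.length : ℕ∞) < G.egirth) : ω.walkLabel p = 1 := by
  classical
  rw [← ω.walkLabel_bypass p hp, (Walk.isPath_iff_nil.1 p.bypass_isPath).eq_nil]
  rfl

end Walks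

/-! ### Words in Rips-Segev graphs -/

/-- The action of the free group on `ℤ → ℤ` through the wreath product `ℤ ≀ ℤ`. -/
def lampAction : FreeGroup Gen →* Equiv.Perm (ℤ → ℤ) :=
  FreeGroup.lift fun
    | .a => Equiv.addRight (Pi.single 0 1)
    | .b => Equiv.arrowCongr (Equiv.addRight 1) (Equiv.refl ℤ)

theorem addRight_zpow_apply {A : Type*} [AddGroup A] (x y : A) (m : ℤ) :
    (Equiv.addRight x ^ m) y = y + m • x := by
  induction m using Int.induction_on generalizing y with
  | zero => simp
  | succ m ih =>
    rw [zpow_add_one, Equiv.Perm.mul_apply, ih, Equiv.coe_addRight, add_assoc, add_comm (m : ℤ),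
      one_add_zsmul]
  | pred m ih =>
    have h : (Equiv.addRight x)⁻¹ y = y + -x := rfl
    rw [zpow_sub_one, Equiv.Perm.mul_apply, ih, h, add_assoc, sub_eq_add_neg, add_comm (-(m : ℤ)), add_zsmul, neg_one_zsmul]

/-- `a` lights the lamp at `0` and `b` shifts the lamps, so the exponents of `a` between successive
letters `b` appear in successive coordinates. -/
theorem lampAction_zpow_mul_b_mul (m : ℤ) (γ : FreeGroup Gen) (n : ℤ) :
    lampAction (FreeGroup.of .a ^ m * FreeGroup.of .b * γ) 0 n =
      lampAction γ 0 (n - 1) + if n = 0 then m else 0 := by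
  have h1 : lampAction (.of .a) = Equiv.addRight (Pi.single 0 1) := FreeGroup.lift_apply_of
  have h2 : lampAction (.of .b) = Equiv.arrowCongr (Equiv.addRight 1) (Equiv.refl ℤ) :=
    FreeGroup.lift_apply_of
  rw [map_mul, map_mul, map_zpow, h1, h2, Equiv.Perm.mul_apply, Equiv.Perm.mul_apply,
    addRight_zpow_apply]
  simp [Equiv.arrowCongr, Pi.single_apply, sub_eq_add_neg]

namespace Coefficients

variable (D : Coefficients)

/-- The exponent of `a` that is read on the way from a vertex to an end of its `a`-line. -/
def toEnd (u : D.Vertex) (t : Bool) : ℤ := (if t then D.C u.1 else 0 : ℤ) - (u.2 : ℕ)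

/-- The element that is read from `u` when one repeatedly moves to the end of the `a`-line that is
given by the next bit and then along the `b`-edge starting there. -/
def pathLabel : D.Vertex → List Bool → FreeGroup Gen
  | _, [] => 1
  | u, t :: s => FreeGroup.of .a ^ D.toEnd u t * FreeGroup.of .b * pathLabel (D.step1 (u.1, t)) s

/-- The terminal vertex of the path of `pathLabel`. -/
def pathEnd : D.Vertex → List Bool → D.Vertex
  | u, [] => u
  | u, t :: s => pathEnd (D.step1 (u.1, t)) s

theorem lampAction_pathLabel (u : D.Vertex) (s : List Bool) {n : ℤ} (hn : n < 0) :
    lampAction (D.pathLabel u s) 0 n = 0 := by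
  induction s generalizing u n with
  | nil => simp [pathLabel]
  | cons t s ih =>
    rw [pathLabel, lampAction_zpow_mul_b_mul, ih _ (by omega), if_neg hn.ne, add_zero]

/-- Coordinate `0` of the lamp configuration is the first exponent. It determines the first bit,
because the exponents leading to the two ends of a line differ by `C i > 0`; then cancel and induct.
-/
theorem pathLabel_injective (u : D.Vertex) {s s' : List Bool} (hl : s.length = s'.length)
    (h : D.pathLabel u s = D.pathLabel u s') : s = s' := by
  induction s generalizing u s' with
  | nil => exact (List.length_eq_zero_iff.1 hl.symm).symm
  | cons t s ih =>
    obtain _ | ⟨t', s'⟩ := s'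
    · simp at hl
    have h0 := congrFun (congrArg (fun γ => lampAction γ 0) h) 0
    simp only [pathLabel] at h0
    rw [lampAction_zpow_mul_b_mul, lampAction_zpow_mul_b_mul,
      lampAction_pathLabel _ _ _ (by norm_num), lampAction_pathLabel _ _ _ (by norm_num)] at h0
    have hC := D.C_pos u.1
    have ht : t = t' := by
      simp only [toEnd, if_true, zero_add] at h0
      cases t <;> cases t' <;> simp at h0 ⊢ <;> omega
    subst ht
    simp only [pathLabel] at h
    rw [ih _ (by simpa using hl) (mul_left_cancel h)]

end Coefficients

end RipsSegev

namespace RipsSegev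

open SimpleGraph

/-! ### Folding a spread labeling -/

section Fold

variable {V : Type*} {G : SimpleGraph V}

/-- The labels of all paths of length between `L` and `2 * L` contain more than `B` letters `b`. -/
def Labeling.IsSpread (ω : Labeling G) (L B : ℕ) : Prop :=
  ∀ ⦃x y : V⦄ (p : G.Walk x y), p.IsPath → L ≤ p.length → p.length ≤ 2 * L →
    B < bCount (ω.walkLabel p)

/-- The element `γ` is read along a short walk in `G` that starts at `x` and ends in the class
`Y`. -/
def Labeling.ShortLift (ω : Labeling G) (L : ℕ) (x : V) (γ : FreeGroup Gen)
    (Y : Quot ω.toLabeledGraph.FoldRel) : Prop :=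
  ∃ (y : V) (p : G.Walk x y), Quot.mk _ y = Y ∧ p.length < L ∧ ω.walkLabel p = γ

theorem foldRel_of_mk_eq {W : Type*} {Ω : LabeledGraph W} {x y : W}
    (h : Quot.mk Ω.FoldRel x = Quot.mk Ω.FoldRel y) : Ω.FoldRel x y :=
  (Equivalence.eqvGen_iff ⟨.refl, .symm, .trans⟩).1 (Quot.eqvGen_exact h)

namespace Labeling.IsSpread

variable {ω : Labeling G} {L B : ℕ} (hω : ω.IsSpread L B) (hL : 0 < L)
  (hg : ((3 * L : ℕ) : ℕ∞) < G.egirth)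

include hω hL hg

/-- The gap argument: after removal of backtracks the length cannot lie in `[L, 2 * L]`, so it is
below `L`. This restores the bound `L` after each extension. -/
theorem exists_short {x y : V} (p : G.Walk x y) (hp : p.length ≤ 2 * L)
    (hB : bCount (ω.walkLabel p) ≤ B) :
    ∃ q : G.Walk x y, q.length < L ∧ ω.walkLabel q = ω.walkLabel p := by
  classical
  have hlab : ω.walkLabel p.bypass = ω.walkLabel p :=
    ω.walkLabel_bypass p (lt_of_le_of_lt (by exact_mod_cast hp.trans (by omega)) hg)
  refine ⟨p.bypass, ?_, hlab⟩
  by_contra! h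
  have := hω p.bypass p.bypass_isPath h (p.length_bypass_le_length.trans hp)
  rw [hlab] at this
  omega

theorem exists_short_of_foldRel {x y : V} (h : ω.toLabeledGraph.FoldRel x y) :
    ∃ q : G.Walk x y, q.length < L ∧ ω.walkLabel q = 1 := by
  have key {x y : V} (p : G.Walk x y) (hp : p.length ≤ 2 * L) (h1 : ω.walkLabel p = 1) :
      ∃ q : G.Walk x y, q.length < L ∧ ω.walkLabel q = 1 := by
    obtain ⟨q, hq, hq'⟩ := hω.exists_short hL hg p hp (by simp [h1, bCount_one])
    exact ⟨q, hq, hq'.trans h1⟩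
  induction h with
  | refl x => exact ⟨.nil, hL, rfl⟩
  | symm _ ih =>
    obtain ⟨q, hq, h1⟩ := ih
    exact ⟨q.reverse, by simpa using hq, by simp [walkLabel_reverse, h1]⟩
  | trans _ _ ih ih' =>
    obtain ⟨q, hq, h1⟩ := ih
    obtain ⟨q', hq', h1'⟩ := ih'
    exact key (q.append q') (by rw [Walk.length_append]; omega) (by simp [walkLabel_append, *])
  | out _ e e' ih =>
    obtain ⟨q, hq, h1⟩ := ih
    refine key ((Walk.cons e.1 .nil).reverse.append (q.append (.cons e'.1 .nil)))
      (by simp; omega) ?_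
    rw [walkLabel_append, walkLabel_append, walkLabel_reverse, ω.walkLabel_toWalk e,
      ω.walkLabel_toWalk e', h1]
    simp
  | into _ e e' ih =>
    obtain ⟨q, hq, h1⟩ := ih
    refine key ((Walk.cons e.1 .nil).append (q.append (Walk.cons e'.1 .nil).reverse))
      (by simp; omega) ?_
    rw [walkLabel_append, walkLabel_append, walkLabel_reverse, ω.walkLabel_toWalk e,
      ω.walkLabel_toWalk e', h1]
    simp

/-- The edge may start at another representative of `Y`; a short walk with trivial label leads
there. The total length is at most `2 * L - 1`, so the walk can be shortened again. -/
theorem shortLift_mul {x : V} {γ : FreeGroup Gen} {Y Z : Quot ω.toLabeledGraph.FoldRel} {g : Gen}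
    (h : ω.ShortLift L x γ Y) (e : ω.toLabeledGraph.fold.edge g Y Z)
    (hB : bCount (γ * FreeGroup.of g) ≤ B) : ω.ShortLift L x (γ * FreeGroup.of g) Z := by
  obtain ⟨y, p, rfl, hp, rfl⟩ := h
  obtain ⟨y', z, hy, rfl, e⟩ := e
  obtain ⟨q, hq, h1⟩ := hω.exists_short_of_foldRel hL hg (foldRel_of_mk_eq hy.symm)
  have hlab : ω.walkLabel (p.append (q.append (.cons e.1 .nil))) =
      ω.walkLabel p * FreeGroup.of g := by
    rw [walkLabel_append, walkLabel_append, ω.walkLabel_toWalk e, h1, one_mul]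
  obtain ⟨r, hr, hr'⟩ := hω.exists_short hL hg (p.append (q.append (.cons e.1 .nil)))
    (by simp; omega) (by rwa [hlab])
  exact ⟨z, r, rfl, hr, hr'.trans hlab⟩

theorem shortLift_mul_inv {x : V} {γ : FreeGroup Gen} {Y Z : Quot ω.toLabeledGraph.FoldRel}
    {g : Gen} (h : ω.ShortLift L x γ Y) (e : ω.toLabeledGraph.fold.edge g Z Y)
    (hB : bCount (γ * (FreeGroup.of g)⁻¹) ≤ B) :
    ω.ShortLift L x (γ * (FreeGroup.of g)⁻¹) Z := by
  obtain ⟨y, p, rfl, hp, rfl⟩ := h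
  obtain ⟨z, y', rfl, hy, e⟩ := e
  obtain ⟨q, hq, h1⟩ := hω.exists_short_of_foldRel hL hg (foldRel_of_mk_eq hy.symm)
  have hlab : ω.walkLabel (p.append (q.append (Walk.cons e.1 .nil).reverse)) =
      ω.walkLabel p * (FreeGroup.of g)⁻¹ := by
    rw [walkLabel_append, walkLabel_append, walkLabel_reverse, ω.walkLabel_toWalk e, h1, one_mul]
  obtain ⟨r, hr, hr'⟩ := hω.exists_short hL hg (p.append (q.append (Walk.cons e.1 .nil).reverse))
    (by simp; omega) (by rwa [hlab])
  exact ⟨z, r, rfl, hr, hr'.trans hlab⟩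

theorem shortLift_unique {x : V} {γ γ' : FreeGroup Gen} {Y : Quot ω.toLabeledGraph.FoldRel}
    (h : ω.ShortLift L x γ Y) (h' : ω.ShortLift L x γ' Y) : γ = γ' := by
  obtain ⟨y, p, rfl, hp, rfl⟩ := h
  obtain ⟨y', p', hy, hp', rfl⟩ := h'
  obtain ⟨q, hq, h1⟩ := hω.exists_short_of_foldRel hL hg (foldRel_of_mk_eq hy.symm)
  have := ω.walkLabel_eq_one (p.append (q.append p'.reverse))
    (lt_of_le_of_lt (by norm_cast; simp; omega) hg)
  rw [walkLabel_append, walkLabel_append, walkLabel_reverse, h1, one_mul] at this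
  exact mul_inv_eq_one.1 this

section Morphism

variable {D : Coefficients} {φ : D.Vertex → Quot ω.toLabeledGraph.FoldRel}
  (hφ : ∀ g x y, D.graph.edge g x y → ω.toLabeledGraph.fold.edge g (φ x) (φ y))

include hφ

/-- Letters `a` do not count towards `B`, so the lift stays short along an `a`-line of any length.
-/
theorem shortLift_right {x : V} {γ : FreeGroup Gen} (i : Fin D.K) (l n : ℕ) (hn : l + n ≤ D.C i)
    (h : ω.ShortLift L x γ (φ ⟨i, ⟨l, by omega⟩⟩)) (hB : bCount γ ≤ B) :
    ω.ShortLift L x (γ * FreeGroup.of .a ^ n) (φ ⟨i, ⟨l + n, by omega⟩⟩) ∧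
      bCount (γ * FreeGroup.of .a ^ n) ≤ bCount γ := by
  induction n with
  | zero => simpa using h
  | succ n ih =>
    obtain ⟨h1, h2⟩ := ih (by omega) h
    have h3 := bCount_mul_le (γ * FreeGroup.of .a ^ n) (.of .a)
    rw [bCount_a] at h3
    rw [pow_succ, ← mul_assoc]
    exact ⟨hω.shortLift_mul hL hg h1 (hφ .a _ _ ⟨rfl, rfl⟩) (by omega), by omega⟩

theorem shortLift_left {x : V} {γ : FreeGroup Gen} (i : Fin D.K) (l n : ℕ) (hl : l ≤ D.C i)
    (hn : n ≤ l) (h : ω.ShortLift L x γ (φ ⟨i, ⟨l, by omega⟩⟩)) (hB : bCount γ ≤ B) :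
    ω.ShortLift L x (γ * (FreeGroup.of .a)⁻¹ ^ n) (φ ⟨i, ⟨l - n, by omega⟩⟩) ∧
      bCount (γ * (FreeGroup.of .a)⁻¹ ^ n) ≤ bCount γ := by
  induction n with
  | zero => simpa using h
  | succ n ih =>
    obtain ⟨h1, h2⟩ := ih (by omega) h
    have h3 := bCount_mul_le (γ * (FreeGroup.of .a)⁻¹ ^ n) (.of .a)⁻¹
    rw [bCount_a_inv] at h3
    rw [pow_succ, ← mul_assoc]
    refine ⟨hω.shortLift_mul_inv hL hg h1 (hφ .a _ _ ⟨rfl, ?_⟩) (by omega), by omega⟩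
    simp only
    omega

theorem shortLift_toEnd {x : V} {γ : FreeGroup Gen} (u : D.Vertex) (t : Bool)
    (h : ω.ShortLift L x γ (φ u)) (hB : bCount γ ≤ B) :
    ω.ShortLift L x (γ * FreeGroup.of .a ^ D.toEnd u t) (φ (D.lineEnd (u.1, t))) ∧
      bCount (γ * FreeGroup.of .a ^ D.toEnd u t) ≤ bCount γ := by
  obtain ⟨i, l, hl⟩ := u
  cases t with
  | true =>
    have := hω.shortLift_right hL hg hφ i l (D.C i - l) (by omega) h hB
    have e1 : D.toEnd ⟨i, l, hl⟩ true = ((D.C i - l : ℕ) : ℤ) := by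
      simp only [Coefficients.toEnd, if_true]
      omega
    have e2 : D.lineEnd (i, true) = ⟨i, ⟨l + (D.C i - l), by omega⟩⟩ := by
      simp only [Coefficients.lineEnd, if_true, Sigma.mk.injEq, heq_eq_eq, true_and, Fin.ext_iff,
        Fin.val_last]
      omega
    rw [e1, zpow_natCast]
    simpa only [e2] using this
  | false =>
    have := hω.shortLift_left hL hg hφ i l l (by omega) le_rfl h hB
    have e1 : D.toEnd ⟨i, l, hl⟩ false = -(l : ℤ) := by
      simp [Coefficients.toEnd]
    have e2 : D.lineEnd (i, false) = ⟨i, ⟨l - l, by omega⟩⟩ := by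
      simp [Coefficients.lineEnd]
    rw [e1, zpow_neg, zpow_natCast, ← inv_pow]
    simpa only [e2] using this

theorem shortLift_path {x : V} {γ : FreeGroup Gen} (u : D.Vertex) (s : List Bool)
    (h : ω.ShortLift L x γ (φ u)) (hB : bCount γ + s.length ≤ B) :
    ω.ShortLift L x (γ * D.pathLabel u s) (φ (D.pathEnd u s)) := by
  induction s generalizing u γ with
  | nil => simpa [Coefficients.pathLabel, Coefficients.pathEnd] using h
  | cons t s ih =>
    rw [List.length_cons] at hB
    obtain ⟨h1, h2⟩ := hω.shortLift_toEnd hL hg hφ u t h (by omega)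
    have h3 := bCount_mul_le (γ * FreeGroup.of .a ^ D.toEnd u t) (.of .b)
    rw [bCount_b] at h3
    have h4 := hω.shortLift_mul hL hg h1 (hφ .b _ _ (.inl ⟨(u.1, t), rfl, rfl⟩)) (by omega)
    have := ih (D.step1 (u.1, t)) h4 (by omega)
    simpa only [Coefficients.pathLabel, Coefficients.pathEnd, mul_assoc] using this

theorem two_pow_le_card [Finite V] : 2 ^ B ≤ Nat.card V := by
  let u : D.Vertex := ⟨⟨0, D.K_pos⟩, 0⟩
  obtain ⟨x, hx⟩ := Quot.exists_rep (φ u)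
  have hinj : Function.Injective fun s : List.Vector Bool B => φ (D.pathEnd u s.1) := by
    intro s s' h
    have hlift (s : List.Vector Bool B) :
        ω.ShortLift L x (D.pathLabel u s.1) (φ (D.pathEnd u s.1)) := by
      simpa using hω.shortLift_path hL hg hφ (γ := 1) u s.1 ⟨x, .nil, hx, hL, rfl⟩
        (by simp [bCount_one])
    have h' := hlift s'
    rw [← show φ (D.pathEnd u s.1) = φ (D.pathEnd u s'.1) from h] at h'
    exact Subtype.ext (D.pathLabel_injective u (by simp)
      (hω.shortLift_unique hL hg (hlift s) h'))
  calc 2 ^ B = Nat.card (List.Vector Bool B) := by simp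
    _ ≤ Nat.card (Quot ω.toLabeledGraph.FoldRel) := Nat.card_le_card_of_injective _ hinj
    _ ≤ Nat.card V := Nat.card_le_card_of_surjective _ Quot.mk_surjective

end Morphism

theorem not_containsRipsSegev [Finite V] (hV : Nat.card V < 2 ^ B) :
    ¬ ContainsRipsSegev ω.toLabeledGraph.fold := by
  rintro ⟨D, -, ⟨φ, -, hφ⟩ | ⟨c, -, φ, -, hφ⟩⟩
  · exact absurd (hω.two_pow_le_card hL hg hφ) (by omega)
  -- Gluing on the paths and folding still leaves a label-preserving map from `D.graph`, which
  -- suffices for the count.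
  · refine absurd (hω.two_pow_le_card hL hg (D := D)
      (φ := fun x => φ (Quot.mk _ (Quot.mk _ (.inl x)))) fun g x y h => hφ _ _ _ ?_) (by omega)
    exact ⟨_, _, rfl, rfl, .inl x, .inl y, rfl, rfl, h⟩

end Labeling.IsSpread

end Fold

end RipsSegev

namespace RipsSegev

open SimpleGraph

/-! ### Random labelings and the union bound -/

section Prob

variable {V : Type*} {G : SimpleGraph V}

instance [Finite V] : Finite (Labeling G) := by
  have : Finite G.Dart :=
    Finite.of_injective (fun d : G.Dart => d.toProd) (Dart.toProd_injective)
  unfold Labeling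
  infer_instance

instance : Nonempty (Labeling G) := by
  classical
  let : LinearOrder V := linearOrderOfSTO WellOrderingRel
  refine ⟨⟨fun d => (.a, decide (d.fst < d.snd)), fun d => ?_⟩⟩
  have h : d.fst ≠ d.snd := d.adj.ne
  simp only [Dart.symm, Prod.fst_swap, Prod.snd_swap, Prod.mk.injEq, true_and]
  rcases lt_or_gt_of_ne h with h | h <;> simp [h, h.not_gt]

/-- The translations of the set of letters, considered as a Klein four-group. -/
def letterShift (τ l : Gen × Bool) : Gen × Bool :=
  (if τ.1 = l.1 then .a else .b, τ.2 ^^ l.2)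

theorem letterShift_letterShift (τ l : Gen × Bool) : letterShift τ (letterShift τ l) = l := by
  obtain ⟨_ | _, _ | _⟩ := τ <;> obtain ⟨_ | _, _ | _⟩ := l <;> rfl

theorem letterShift_inv (τ l : Gen × Bool) :
    letterShift τ (l.1, !l.2) = ((letterShift τ l).1, !(letterShift τ l).2) := by
  simp [letterShift]

theorem sum_letterShift (f : Gen × Bool → ℝ) (l : Gen × Bool) :
    ∑ τ, f (letterShift τ l) = ∑ l', f l' := by
  obtain ⟨_ | _, _ | _⟩ := l <;> simp [sum_letter, letterShift] <;> ring

namespace Labeling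

open scoped Classical in
/-- The labeling obtained by translating the labels of the edge `e`. -/
noncomputable def shift (e : Sym2 V) (τ : Gen × Bool) (ω : Labeling G) : Labeling G :=
  ⟨fun d => if d.edge = e then letterShift τ (ω.1 d) else ω.1 d, fun d => by
    simp only [Dart.edge_symm, ω.2 d]
    split_ifs
    · exact letterShift_inv _ _
    · rfl⟩

theorem shift_involutive (e : Sym2 V) (τ : Gen × Bool) :
    Function.Involutive (shift (G := G) e τ) := by
  intro ω
  refine Subtype.ext (funext fun d => ?_)
  simp only [shift]
  split_ifs
  · exact letterShift_letterShift _ _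
  · rfl

theorem walkLabel_shift (e : Sym2 V) (τ : Gen × Bool) (ω : Labeling G) {x y : V}
    (p : G.Walk x y) (he : e ∉ p.edges) : (ω.shift e τ).walkLabel p = ω.walkLabel p := by
  induction p with
  | nil => rfl
  | cons h p ih =>
    rw [Walk.edges_cons, List.mem_cons, not_or] at he
    rw [walkLabel, walkLabel, ih he.2]
    simp only [shift]
    rw [if_neg (fun h' => he.1 h'.symm)]

theorem sum_weight_walkLabel_le [Fintype (Labeling G)] {x y : V} (p : G.Walk x y)
    (hp : p.IsPath) :
    ∑ ω : Labeling G, weight (ω.walkLabel p) ≤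
      (97 / 100) ^ p.length * Fintype.card (Labeling G) := by
  induction p with
  | nil => simp [walkLabel, weight_one]
  | @cons u w z h p ih =>
    rw [Walk.cons_isPath_iff] at hp
    have he : s(u, w) ∉ p.edges := fun he => hp.2 (p.fst_mem_support_of_mem_edges he)
    -- Translating the label of the first edge permutes the labelings and leaves the label of `p`
    -- unchanged. Averaging over `τ` makes the first letter uniform and independent of the rest.
    have h1 (τ : Gen × Bool) : ∑ ω : Labeling G, weight (ω.walkLabel (.cons h p)) =
        ∑ ω : Labeling G,
          weight (FreeGroup.mk [letterShift τ (ω.1 ⟨(u, w), h⟩)] * ω.walkLabel p) := by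
      rw [← Equiv.sum_comp (shift_involutive s(u, w) τ).toPerm]
      refine Finset.sum_congr rfl fun ω _ => ?_
      simp only [Function.Involutive.coe_toPerm, walkLabel]
      rw [walkLabel_shift _ _ _ _ he]
      simp [shift]
    have h2 : 4 * ∑ ω : Labeling G, weight (ω.walkLabel (.cons h p)) ≤
        4 * (97 / 100) * ∑ ω : Labeling G, weight (ω.walkLabel p) := by
      calc _ = ∑ τ : Gen × Bool, ∑ ω : Labeling G, weight (ω.walkLabel (.cons h p)) := by
            rw [sum_letter]
            ring
        _ = ∑ ω : Labeling G, ∑ τ : Gen × Bool,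
              weight (FreeGroup.mk [letterShift τ (ω.1 ⟨(u, w), h⟩)] * ω.walkLabel p) := by
            exact (Finset.sum_congr rfl fun τ _ => h1 τ).trans Finset.sum_comm
        _ ≤ _ := by
            rw [Finset.mul_sum]
            refine Finset.sum_le_sum fun ω _ => ?_
            rw [sum_letterShift fun l => weight (FreeGroup.mk [l] * ω.walkLabel p)]
            exact sum_weight_letter_mul_le _
    have h3 := ih hp.1
    rw [Walk.length_cons, pow_succ]
    linarith

/-- Markov's inequality: each labeling counted has weight at least `(3 / 5) ^ B`. -/
theorem card_bCount_le [Finite V] {x y : V} (p : G.Walk x y) (hp : p.IsPath) (B : ℕ) :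
    (Nat.card {ω : Labeling G // bCount (ω.walkLabel p) ≤ B} : ℝ) ≤
      (5 / 3) ^ B * (97 / 100) ^ p.length * Nat.card (Labeling G) := by
  classical
  let := Fintype.ofFinite (Labeling G)
  have h1 : (Nat.card {ω : Labeling G // bCount (ω.walkLabel p) ≤ B} : ℝ) * (3 / 5) ^ B ≤
      ∑ ω : Labeling G, weight (ω.walkLabel p) := by
    rw [Nat.card_eq_fintype_card, Fintype.card_subtype, ← nsmul_eq_mul]
    refine (Finset.card_nsmul_le_sum _ _ _ fun ω hω =>
      pow_le_weight (Finset.mem_filter.1 hω).2).trans ?_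
    exact Finset.sum_le_sum_of_subset_of_nonneg (Finset.subset_univ _)
      fun ω _ _ => weight_nonneg _
  have h2 := h1.trans (sum_weight_walkLabel_le p hp)
  rw [← le_div_iff₀ (by positivity)] at h2
  refine h2.trans_eq ?_
  rw [Nat.card_eq_fintype_card, show (5 / 3 : ℝ) = (3 / 5)⁻¹ by norm_num, inv_pow]
  ring

/-- If short closed walks are trivial, then all but a few labelings are spread. -/
theorem card_not_isSpread_le [Finite V] {L B : ℕ} (hg : ((4 * L : ℕ) : ℕ∞) < G.egirth) :
    (Nat.card {ω : Labeling G // ¬ ω.IsSpread L B} : ℝ) ≤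
      Nat.card V ^ 2 * ((5 / 3) ^ B * (97 / 100) ^ L) * Nat.card (Labeling G) := by
  classical
  let := Fintype.ofFinite V
  let := Fintype.ofFinite (Labeling G)
  let A (z : V × V) : Finset (Labeling G) := {ω | ∃ p : G.Walk z.1 z.2, p.IsPath ∧
    L ≤ p.length ∧ p.length ≤ 2 * L ∧ bCount (ω.walkLabel p) ≤ B}
  have hA (z : V × V) : ((A z).card : ℝ) ≤
      (5 / 3) ^ B * (97 / 100) ^ L * Nat.card (Labeling G) := by
    by_cases hz : ∃ p : G.Walk z.1 z.2, p.IsPath ∧ L ≤ p.length ∧ p.length ≤ 2 * L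
    · obtain ⟨p, hp, h1, h2⟩ := hz
      have hsub : A z ⊆ ({ω | bCount (ω.walkLabel p) ≤ B} : Finset (Labeling G)) := by
        intro ω hω
        obtain ⟨q, -, -, h3, h4⟩ := (Finset.mem_filter.1 hω).2
        refine Finset.mem_filter.2 ⟨Finset.mem_univ _, ?_⟩
        -- Two such paths with the same ends form a closed walk of length at most `4 * L`, so their
        -- labels agree. Hence one path per pair of vertices suffices in the union bound.
        have := ω.walkLabel_eq_one (p.append q.reverse)
          (lt_of_le_of_lt (by norm_cast; simp; omega) hg)
        rw [walkLabel_append, walkLabel_reverse, mul_inv_eq_one] at this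
        rwa [this]
      have h3 := card_bCount_le p hp B
      rw [Nat.card_eq_fintype_card, Fintype.card_subtype] at h3
      calc ((A z).card : ℝ) ≤ _ := by exact_mod_cast Finset.card_le_card hsub
        _ ≤ _ := h3
        _ ≤ _ := by
          gcongr ?_ * ?_ * ?_
          exact pow_le_pow_of_le_one (by norm_num) (by norm_num) h1
    · have : A z = ∅ := by
        refine Finset.eq_empty_of_forall_notMem fun ω hω => hz ?_
        obtain ⟨p, h1, h2, h3, -⟩ := (Finset.mem_filter.1 hω).2
        exact ⟨p, h1, h2, h3⟩
      rw [this, Finset.card_empty, Nat.cast_zero]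
      positivity
  have hsub : ({ω | ¬ ω.IsSpread L B} : Finset (Labeling G)) ⊆ Finset.univ.biUnion A := by
    intro ω hω
    have := (Finset.mem_filter.1 hω).2
    simp only [IsSpread, not_forall, not_lt] at this
    obtain ⟨x, y, p, h1, h2, h3, h4⟩ := this
    exact Finset.mem_biUnion.2
      ⟨(x, y), Finset.mem_univ _, Finset.mem_filter.2 ⟨Finset.mem_univ _, p, h1, h2, h3, h4⟩⟩
  calc (Nat.card {ω : Labeling G // ¬ ω.IsSpread L B} : ℝ)
      = (({ω | ¬ ω.IsSpread L B} : Finset (Labeling G)).card : ℝ) := by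
        rw [Nat.card_eq_fintype_card, Fintype.card_subtype]
    _ ≤ ((∑ z, (A z).card : ℕ) : ℝ) := by
        exact_mod_cast (Finset.card_le_card hsub).trans Finset.card_biUnion_le
    _ ≤ ∑ z : V × V, (5 / 3) ^ B * (97 / 100) ^ L * (Nat.card (Labeling G) : ℝ) := by
        rw [Nat.cast_sum]
        exact Finset.sum_le_sum fun z _ => hA z
    _ = _ := by
        rw [Finset.sum_const, Finset.card_univ, Fintype.card_prod, nsmul_eq_mul,
          Nat.card_eq_fintype_card (α := V)]
        push_cast
        ring

end Labeling

theorem one_sub_le_labelingProb [Finite V] {P Q : Labeling G → Prop} {ε : ℝ}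
    (hQ : (Nat.card {ω // ¬ Q ω} : ℝ) ≤ ε * Nat.card (Labeling G)) (h : ∀ ω, Q ω → P ω) :
    1 - ε ≤ labelingProb G P := by
  classical
  let := Fintype.ofFinite (Labeling G)
  have hpos : (0 : ℝ) < Nat.card (Labeling G) := by exact_mod_cast Nat.card_pos
  have h1 : Nat.card {ω // Q ω} ≤ Nat.card {ω // P ω} :=
    Nat.card_le_card_of_injective _ (Subtype.map_injective h Function.injective_id)
  have h2 : Nat.card {ω // Q ω} + Nat.card {ω // ¬ Q ω} = Nat.card (Labeling G) := by
    simp only [Nat.card_eq_fintype_card]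
    rw [Fintype.card_subtype_compl, Nat.add_sub_cancel' (Fintype.card_subtype_le _)]
  have h1' : (Nat.card {ω // Q ω} : ℝ) ≤ Nat.card {ω // P ω} := by exact_mod_cast h1
  have h2' : (Nat.card {ω // Q ω} : ℝ) + Nat.card {ω // ¬ Q ω} = Nat.card (Labeling G) := by
    exact_mod_cast h2
  rw [labelingProb, le_div_iff₀ hpos]
  linarith

end Prob

end RipsSegev

namespace RipsSegev

open SimpleGraph

variable {V : Type*}

/-! ### Cycles and girth -/

/-- In a forest without leaves, a path can be prolonged at its start forever: a new neighbour
already on the path would, by uniqueness of paths, be its second vertex. -/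
theorem not_isAcyclic_of_exists_ne_adj [Finite V] {H : SimpleGraph V} {u₀ w₀ : V}
    (h₀ : H.Adj u₀ w₀) (h : ∀ u w, H.Adj u w → ∃ w', w' ≠ w ∧ H.Adj u w') : ¬ H.IsAcyclic := by
  classical
  let := Fintype.ofFinite V
  intro hH
  have key (n : ℕ) : ∃ (u w : V) (p : H.Walk u w), p.IsPath ∧ p.length = n + 1 := by
    induction n with
    | zero => exact ⟨u₀, w₀, .cons h₀ .nil, by simp [h₀.ne], rfl⟩
    | succ n ih =>
      obtain ⟨u, w, p, hp, hl⟩ := ih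
      cases p with
      | nil => simp at hl
      | @cons _ x _ hx q =>
        obtain ⟨y, hyx, hy⟩ := h u x hx
        refine ⟨y, w, .cons hy.symm (.cons hx q), ?_, by rw [Walk.length_cons, hl]⟩
        refine (Walk.cons_isPath_iff _ _).2 ⟨hp, fun hmem => hyx ?_⟩
        have h1 := (hH.subsingleton_path u y).elim ⟨_, hp.takeUntil hmem⟩
          ⟨.cons hy .nil, by simp [hy.ne]⟩
        have h2 := (Walk.cons hx q).take_spec hmem
        rw [Subtype.mk.injEq] at h1
        rw [h1, Walk.cons_append] at h2
        injection h2
  obtain ⟨u, w, p, hp, hl⟩ := key (Fintype.card V)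
  have := hp.length_lt
  omega

/-! ### The girth of a subdivision -/

section Pt

variable {j k k' : ℕ} {u w u' w' : V}

theorem count_pt [DecidableEq V] (j : ℕ) (u w : V) (k : ℕ) (z : V) :
    (pt j u w k).count z = (if u = z then j - k else 0) + if w = z then k else 0 := by
  simp [pt, Multiset.count_replicate]

theorem pt_swap (hk : k ≤ j) : pt j u w k = pt j w u (j - k) := by
  rw [pt, pt, Nat.sub_sub_self hk, add_comm]

theorem pt_eq_pt (huw : u ≠ w) (huw' : u' ≠ w') (h0 : 0 < k) (hk : k < j) (hk' : k' ≤ j)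
    (h : pt j u w k = pt j u' w' k') :
    u' = u ∧ w' = w ∧ k' = k ∨ u' = w ∧ w' = u ∧ k' = j - k := by
  classical
  have hu := congrArg (Multiset.count u) h
  have hw := congrArg (Multiset.count w) h
  simp only [count_pt] at hu hw
  grind

theorem pt_zero_eq_pt (huw' : u' ≠ w') (hk' : k' < j) (h : pt j u w 0 = pt j u' w' k') :
    u' = u ∧ k' = 0 := by
  classical
  have hu := congrArg (Multiset.count u) h
  have hu' := congrArg (Multiset.count u') h
  simp only [count_pt] at hu hu'
  grind

theorem edge_pt_eq (huw : u ≠ w) (huw' : u' ≠ w') (hk : k < j) (hk' : k' < j)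
    (h : s(pt j u w k, pt j u w (k + 1)) = s(pt j u' w' k', pt j u' w' (k' + 1))) :
    s(u, w) = s(u', w') ∧ (u = u' → k = k') := by
  classical
  rcases Sym2.eq_iff.1 h with ⟨h1, h2⟩ | ⟨h1, h2⟩
  all_goals
    have hu := congrArg (Multiset.count u) h1
    have hw := congrArg (Multiset.count w) h1
    have hu2 := congrArg (Multiset.count u) h2
    have hw2 := congrArg (Multiset.count w) h2
    simp only [count_pt] at hu hw hu2 hw2
    rw [Sym2.eq_iff]
    grind

end Pt

/-- A set `A` of edges of a subdivision that contains no edge with a loose end gives rise to a cycle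
of the original graph all of whose parts are in `A`. -/
theorem exists_cycle_of_subdivision [Finite V] {Δ : SimpleGraph V} {j : ℕ}
    {A : Multiset V → Multiset V → Prop} (hsymm : ∀ m m', A m m' → A m' m)
    (hA : ∀ m m', A m m' → ∃ u w k, Δ.Adj u w ∧ k < j ∧ m = pt j u w k ∧ m' = pt j u w (k + 1))
    (htwo : ∀ m m', A m m' → ∃ m'', m'' ≠ m' ∧ A m m'') (hne : ∃ m m', A m m') :
    ∃ (u : V) (p : Δ.Walk u u), p.IsCycle ∧
      ∀ d ∈ p.darts, ∀ k < j, A (pt j d.fst d.snd k) (pt j d.fst d.snd (k + 1)) := by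
  -- An interior point of a subdivided edge has only two neighbours, so `htwo` forces `A` to
  -- continue straight on.
  have hforward {u w : V} (huw : Δ.Adj u w) {k : ℕ} (n : ℕ) (hn : k + n < j)
      (h : A (pt j u w k) (pt j u w (k + 1))) :
      A (pt j u w (k + n)) (pt j u w (k + n + 1)) := by
    induction n with
    | zero => exact h
    | succ n ih =>
      obtain ⟨m, hm, h'⟩ := htwo _ _ (hsymm _ _ (ih (by omega)))
      obtain ⟨u', w', k', huw', hk', h1, rfl⟩ := hA _ _ h'
      rcases pt_eq_pt huw.ne huw'.ne (by omega) (by omega) hk'.le h1 with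
        ⟨rfl, rfl, rfl⟩ | ⟨rfl, rfl, rfl⟩
      · exact h'
      · refine absurd ?_ hm
        rw [pt_swap (by omega)]
        congr 1
        omega
  have hflip {u w : V} {k : ℕ} (hk : k < j) (h : A (pt j u w k) (pt j u w (k + 1))) :
      A (pt j w u (j - 1 - k)) (pt j w u (j - 1 - k + 1)) := by
    rw [pt_swap hk.le, pt_swap (k := k + 1) hk] at h
    have := hsymm _ _ h
    rwa [show j - (k + 1) = j - 1 - k by omega, show j - k = j - 1 - k + 1 by omega] at this
  have hall {u w : V} (huw : Δ.Adj u w) {k : ℕ} (hk : k < j)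
      (h : A (pt j u w k) (pt j u w (k + 1))) (l : ℕ) (hl : l < j) :
      A (pt j u w l) (pt j u w (l + 1)) := by
    -- Run to the end `w`, turn around, and run back along the whole edge until the required piece.
    have h1 := hflip (by omega) (hforward huw (j - 1 - k) (by omega) h)
    rw [show j - 1 - (k + (j - 1 - k)) = 0 by omega] at h1
    have h2 := hforward huw.symm (j - 1 - l) (by omega) h1
    have h3 := hflip (by omega) h2
    rwa [show j - 1 - (0 + (j - 1 - l)) = l by omega] at h3
  let H : SimpleGraph V :=
    { Adj u w := Δ.Adj u w ∧ ∀ k < j, A (pt j u w k) (pt j u w (k + 1))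
      symm := ⟨fun u w h => ⟨h.1.symm, fun k hk => by
        have := hflip (k := j - 1 - k) (by omega) (h.2 _ (by omega))
        rwa [show j - 1 - (j - 1 - k) = k by omega] at this⟩⟩
      loopless := ⟨fun u h => h.1.ne rfl⟩ }
  have hH : ¬ H.IsAcyclic := by
    obtain ⟨m, m', h⟩ := hne
    obtain ⟨u, w, k, huw, hk, rfl, rfl⟩ := hA _ _ h
    refine not_isAcyclic_of_exists_ne_adj (u₀ := u) (w₀ := w) ⟨huw, hall huw hk h⟩ ?_
    intro u w huw
    -- At a vertex `u` of `Δ`, the second edge of `A` begins another edge of `Δ`, so `H` has no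
    -- leaves.
    obtain ⟨m, hm, h'⟩ := htwo _ _ (huw.2 0 (by omega))
    obtain ⟨u', w', k', huw', hk', h1, rfl⟩ := hA _ _ h'
    obtain ⟨rfl, rfl⟩ := pt_zero_eq_pt huw'.ne hk' h1
    refine ⟨w', fun hw => hm (by rw [hw]), huw', hall huw' hk' ?_⟩
    rwa [← h1]
  obtain ⟨u, p, hp⟩ : ∃ (u : V) (p : H.Walk u u), p.IsCycle := by
    simpa [IsAcyclic] using hH
  have hle : H ≤ Δ := fun u w h => h.1
  refine ⟨u, p.mapLe hle, hp.mapLe hle, fun d hd => ?_⟩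
  rw [Walk.mapLe, Walk.darts_map, List.mem_map] at hd
  obtain ⟨d, -, rfl⟩ := hd
  exact d.adj.2

/-- The edges of a cycle have no loose ends, so they contain all `j` parts of each edge of some
cycle of `Δ`; these parts are pairwise distinct. -/
theorem mul_le_egirth_subdivision [Finite V] {Δ : SimpleGraph V} {δ : ℕ}
    (hδ : (δ : ℕ∞) ≤ Δ.egirth) (j : ℕ) :
    ((j * δ : ℕ) : ℕ∞) ≤ (subdivision Δ j).egirth := by
  classical
  refine le_egirth.2 fun x c hc => ?_
  let f (y : SubdivVertex Δ j) : Multiset V := y.1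
  let T : List (Sym2 (Multiset V)) := c.edges.map (Sym2.map f)
  have hT (m m' : Multiset V) : s(m, m') ∈ T ↔
      ∃ y z, c.toSubgraph.Adj y z ∧ f y = m ∧ f z = m' := by
    simp only [T, List.mem_map]
    constructor
    · rintro ⟨e, he, h⟩
      induction e using Sym2.ind with
      | _ y z =>
      rw [Sym2.map_mk, Sym2.eq_iff] at h
      have he' := (Walk.mem_edges_toSubgraph c).2 he
      rw [Subgraph.mem_edgeSet] at he'
      rcases h with ⟨h1, h2⟩ | ⟨h1, h2⟩
      · exact ⟨y, z, he', h1, h2⟩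
      · exact ⟨z, y, he'.symm, h2, h1⟩
    · rintro ⟨y, z, h, rfl, rfl⟩
      exact ⟨s(y, z), (Walk.mem_edges_toSubgraph c).1 h, rfl⟩
  obtain ⟨u, p, hp, hpT⟩ := exists_cycle_of_subdivision (Δ := Δ) (j := j)
    (A := fun m m' => s(m, m') ∈ T) (fun m m' h => by rwa [Sym2.eq_swap])
    (fun m m' h => by
      obtain ⟨y, z, hyz, rfl, rfl⟩ := (hT _ _).1 h
      obtain ⟨u, w, k, huw, hk, ⟨h1, h2⟩ | ⟨h1, h2⟩⟩ := hyz.adj_sub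
      · exact ⟨u, w, k, huw, hk, h1, h2⟩
      · refine ⟨w, u, j - (k + 1), huw.symm, by omega, ?_, ?_⟩
        · exact h2.trans (pt_swap hk)
        · refine h1.trans ((pt_swap hk.le).trans ?_)
          congr 1
          omega)
    (fun m m' h => by
      obtain ⟨y, z, hyz, rfl, rfl⟩ := (hT _ _).1 h
      have h2 := hc.ncard_neighborSet_toSubgraph_eq_two
        ((Walk.mem_verts_toSubgraph c).1 hyz.fst_mem)
      obtain ⟨z', hz', hne⟩ := Set.exists_ne_of_one_lt_ncard
        (s := c.toSubgraph.neighborSet y) (by omega) z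
      exact ⟨f z', fun h => hne (Subtype.ext h), (hT _ _).2 ⟨y, z', hz', rfl, rfl⟩⟩)
    (by
      cases c with
      | nil => simp at hc
      | @cons _ y _ h q =>
        exact ⟨f x, f y, List.mem_map_of_mem (f := Sym2.map f) (a := s(x, y)) (by simp)⟩)
  have hdarts : p.darts.Nodup := (hp.edges_nodup : (p.darts.map Dart.edge).Nodup).of_map
  have hcard : (p.darts.toFinset ×ˢ Finset.range j).card ≤ T.toFinset.card := by
    refine Finset.card_le_card_of_injOn
      (fun z => s(pt j z.1.fst z.1.snd z.2, pt j z.1.fst z.1.snd (z.2 + 1))) ?_ ?_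
    · intro z hz
      simp only [Finset.coe_product, Set.mem_prod, Finset.mem_coe, List.mem_toFinset,
        Finset.mem_range] at hz ⊢
      exact hpT z.1 hz.1 z.2 hz.2
    · rintro ⟨d, k⟩ hz ⟨d', k'⟩ hz' h
      simp only [Finset.coe_product, Set.mem_prod, Finset.mem_coe, List.mem_toFinset,
        Finset.mem_range] at hz hz'
      obtain ⟨h1, h2⟩ := edge_pt_eq d.adj.ne d'.adj.ne hz.2 hz'.2 h
      have hd : d = d' := List.inj_on_of_nodup_map hp.edges_nodup hz.1 hz'.1 h1
      subst hd
      rw [h2 rfl]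
  rw [Finset.card_product, List.toFinset_card_of_nodup hdarts, Walk.length_darts,
    Finset.card_range] at hcard
  have hT' : T.toFinset.card ≤ c.length :=
    T.toFinset_card_le.trans_eq (by simp [T])
  have hp' : δ ≤ p.length := by exact_mod_cast hδ.trans (egirth_le_length hp)
  norm_cast
  calc j * δ ≤ j * p.length := Nat.mul_le_mul_left _ hp'
    _ = p.length * j := mul_comm _ _
    _ ≤ c.length := hcard.trans hT'

/-! ### The number of vertices -/

/-- Increasing the radius of a ball by one multiplies its size by at most `v + 1`. -/
theorem card_le_pow_diam [Finite V] {Δ : SimpleGraph V} (hΔ : Δ.Connected) {v : ℕ}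
    (hv : ∀ x, (Δ.neighborSet x).ncard ≤ v) : Nat.card V ≤ (v + 1) ^ Δ.diam := by
  classical
  let := Fintype.ofFinite V
  have hne := hΔ.nonempty
  obtain ⟨x⟩ := hne
  have key (n : ℕ) : (Finset.univ.filter fun y => Δ.dist x y ≤ n).card ≤ (v + 1) ^ n := by
    induction n with
    | zero =>
      refine (Finset.card_le_one.2 fun y hy z hz => ?_).trans_eq (pow_zero _).symm
      simp only [Finset.mem_filter, Finset.mem_univ, true_and, Nat.le_zero,
        hΔ.dist_eq_zero_iff] at hy hz
      rw [← hy, hz]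
    | succ n ih =>
      have hsub : (Finset.univ.filter fun y => Δ.dist x y ≤ n + 1) ⊆
          (Finset.univ.filter fun y => Δ.dist x y ≤ n).biUnion
            fun y => insert y (Δ.neighborFinset y) := by
        intro z hz
        simp only [Finset.mem_filter, Finset.mem_univ, true_and, Finset.mem_biUnion,
          Finset.mem_insert, mem_neighborFinset] at hz ⊢
        rcases hz.lt_or_eq with h | h
        · exact ⟨z, by omega, .inl rfl⟩
        · obtain ⟨p, hp⟩ := hΔ.exists_walk_length_eq_dist z x
          rw [dist_comm, h] at hp
          cases p with
          | nil => simp at hp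
          | @cons _ y _ hzy q =>
            refine ⟨y, ?_, .inr hzy.symm⟩
            rw [dist_comm]
            refine (dist_le q).trans ?_
            simpa using hp.le
      refine (Finset.card_le_card hsub).trans ((Finset.card_biUnion_le_card_mul _ _ (v + 1)
        fun y _ => ?_).trans ?_)
      · refine (Finset.card_insert_le _ _).trans (Nat.succ_le_succ ?_)
        have := hv y
        rwa [Set.ncard_eq_toFinset_card'] at this
      · rw [pow_succ]
        exact Nat.mul_le_mul_right _ ih
  refine le_trans ?_ (key Δ.diam)
  rw [Nat.card_eq_fintype_card, ← Finset.card_univ]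
  refine Finset.card_le_card fun y _ => ?_
  have : Nonempty V := ⟨x⟩
  simpa using dist_le_diam (connected_iff_ediam_ne_top.1 hΔ)

theorem subdivVertex_mem_range (Δ : SimpleGraph V) (j : ℕ) (x : SubdivVertex Δ j) :
    ∃ z : V × V × Fin (j + 1), pt j z.1 z.2.1 z.2.2 = x.1 := by
  obtain ⟨m, ⟨u, rfl⟩ | ⟨u, w, k, -, hk, rfl⟩⟩ := x
  · exact ⟨(u, u, 0), rfl⟩
  · exact ⟨(u, w, ⟨k, by omega⟩), rfl⟩

theorem exists_subdivVertex_injective (Δ : SimpleGraph V) (j : ℕ) :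
    ∃ f : SubdivVertex Δ j → V × V × Fin (j + 1), Function.Injective f := by
  choose f hf using subdivVertex_mem_range Δ j
  exact ⟨f, fun x y h => Subtype.ext (by rw [← hf x, ← hf y, h])⟩

instance [Finite V] (Δ : SimpleGraph V) (j : ℕ) : Finite (SubdivVertex Δ j) :=
  let ⟨_, hf⟩ := exists_subdivVertex_injective Δ j
  Finite.of_injective _ hf

theorem card_subdivVertex_le [Finite V] (Δ : SimpleGraph V) (j : ℕ) :
    Nat.card (SubdivVertex Δ j) ≤ (j + 1) * Nat.card V ^ 2 := by
  obtain ⟨f, hf⟩ := exists_subdivVertex_injective Δ j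
  refine (Nat.card_le_card_of_injective f hf).trans_eq ?_
  rw [Nat.card_prod, Nat.card_prod, Nat.card_fin]
  ring

end RipsSegev

namespace RipsSegev

open SimpleGraph

/-! ### Choice of the constants -/

variable {V : Type*}

theorem card_subdivVertex_le_two_pow [Finite V] {Δ : SimpleGraph V} (hΔ : Δ.Connected) {v d : ℕ}
    (hv : ∀ x, (Δ.neighborSet x).ncard ≤ v) (hd : Δ.diam ≤ d) (j : ℕ) :
    Nat.card (SubdivVertex Δ j) ≤ (j + 1) * 2 ^ (2 * (v + 1) * d) := by
  refine (card_subdivVertex_le Δ j).trans (Nat.mul_le_mul_left _ ?_)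
  calc Nat.card V ^ 2 ≤ ((v + 1) ^ d) ^ 2 :=
        Nat.pow_le_pow_left ((card_le_pow_diam hΔ hv).trans
          (Nat.pow_le_pow_right (by omega) hd)) 2
    _ ≤ ((2 ^ (v + 1)) ^ d) ^ 2 := by
        gcongr
        exact Nat.lt_two_pow_self.le
    _ = 2 ^ (2 * (v + 1) * d) := by
        rw [← pow_mul, ← pow_mul]
        congr 1
        ring

/-- Here `L = n * δ`, and `5 * n ≤ j` puts `4 * L` below the girth `j * δ`. With `B = S * δ + (j +
1)`, `2 ^ B` exceeds the number of vertices, as `j + 1 < 2 ^ (j + 1)`. In `20 / 3 = 2 ^ 2 * (5 /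
3)`, the `2 ^ 2` comes from the pairs of vertices and `5 / 3` from Markov's inequality. -/
theorem one_sub_le_labelingProb_subdivision [Finite V] {Δ : SimpleGraph V} {δ j n S : ℕ}
    (hδ : Δ.egirth = δ) (hn : 0 < n) (hj : 5 * n ≤ j)
    (hV : Nat.card (SubdivVertex Δ j) ≤ (j + 1) * 2 ^ (S * δ))
    (hS : (20 / 3 : ℝ) ^ S * (97 / 100) ^ n ≤ Real.exp (-1)) :
    1 - (j + 1) ^ 2 * (5 / 3) ^ (j + 1) * Real.exp (-(1 * δ)) ≤
      labelingProb (subdivision Δ j) fun ω => ¬ ContainsRipsSegev ω.toLabeledGraph.fold := by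
  have hδ3 : 3 ≤ δ := by exact_mod_cast hδ ▸ three_le_egirth (G := Δ)
  have hL : 0 < n * δ := Nat.mul_pos hn (by omega)
  have hg : ((4 * (n * δ) : ℕ) : ℕ∞) < (subdivision Δ j).egirth := by
    refine lt_of_lt_of_le ?_ (mul_le_egirth_subdivision hδ.ge j)
    norm_cast
    nlinarith
  have hB : Nat.card (SubdivVertex Δ j) < 2 ^ (S * δ + (j + 1)) := by
    rw [pow_add]
    refine hV.trans_lt ?_
    rw [mul_comm]
    exact Nat.mul_lt_mul_of_pos_left Nat.lt_two_pow_self (by positivity)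
  refine one_sub_le_labelingProb (Q := fun ω => ω.IsSpread (n * δ) (S * δ + (j + 1)))
    ((Labeling.card_not_isSpread_le hg).trans ?_) fun ω hω =>
      hω.not_containsRipsSegev hL (lt_of_le_of_lt (by norm_cast; omega) hg) hB
  refine mul_le_mul_of_nonneg_right ?_ (Nat.cast_nonneg _)
  have hV' : (Nat.card (SubdivVertex Δ j) : ℝ) ≤ (j + 1) * 2 ^ (S * δ) := by exact_mod_cast hV
  calc (Nat.card (SubdivVertex Δ j) : ℝ) ^ 2 *
        ((5 / 3) ^ (S * δ + (j + 1)) * (97 / 100) ^ (n * δ))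
      ≤ ((j + 1) * 2 ^ (S * δ) : ℝ) ^ 2 *
        ((5 / 3) ^ (S * δ + (j + 1)) * (97 / 100) ^ (n * δ)) := by gcongr
    _ = (j + 1 : ℝ) ^ 2 * (5 / 3) ^ (j + 1) * ((20 / 3) ^ S * (97 / 100) ^ n) ^ δ := by
        rw [show (20 / 3 : ℝ) = 2 ^ 2 * (5 / 3) by norm_num]
        simp only [mul_pow, pow_add, pow_mul]
        rw [pow_right_comm ((2 : ℝ) ^ S) δ 2, pow_right_comm (2 : ℝ) S 2]
        ring
    _ ≤ (j + 1 : ℝ) ^ 2 * (5 / 3) ^ (j + 1) * Real.exp (-1) ^ δ := by gcongr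
    _ = _ := by
        rw [← Real.exp_nat_mul]
        ring_nf

end RipsSegev

open RipsSegev in
theorem mainTheorem10 (v : ℕ) (C : ℝ) (hC : 1 ≤ C) :
    ∃ j₀ : ℕ, ∀ j : ℕ, j₀ ≤ j → ∃ M c : ℝ, 0 < c ∧
      ∀ (ι : Type*) (V : ι → Type*) [∀ i, Finite (V i)] (Δ : ∀ i, SimpleGraph (V i)) (δ : ι → ℕ),
        (∀ i, (Δ i).Connected) →
        (∀ i, (Δ i).egirth = δ i) →
        (∀ i x, ((Δ i).neighborSet x).ncard ≤ v) →
        (∀ i, ((Δ i).diam : ℝ) ≤ C * δ i) →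
        ∀ i, 1 - M * Real.exp (-(c * δ i)) ≤
          labelingProb (subdivision (Δ i) j)
            (fun ω => ¬ ContainsRipsSegev ω.toLabeledGraph.fold) := by
  -- The factor `2` comes from bounding the points of the subdivision by pairs of vertices, `v + 1`
  -- from `v + 1 ≤ 2 ^ (v + 1)`, and `⌈C⌉₊` from the diameter. As `S` does not involve `j`, `n` and
  -- then `j₀` can be chosen afterwards.
  let S : ℕ := 2 * (v + 1) * ⌈C⌉₊
  obtain ⟨n, hn⟩ := exists_pow_lt_of_lt_one
    (show (0 : ℝ) < Real.exp (-1) / (20 / 3) ^ S by positivity)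
    (show (97 / 100 : ℝ) < 1 by norm_num)
  have hS : (20 / 3 : ℝ) ^ S * (97 / 100) ^ (n + 1) ≤ Real.exp (-1) := by
    rw [lt_div_iff₀ (by positivity)] at hn
    have h : (97 / 100 : ℝ) ^ (n + 1) ≤ (97 / 100) ^ n :=
      pow_le_pow_of_le_one (by norm_num) (by norm_num) n.le_succ
    calc (20 / 3 : ℝ) ^ S * (97 / 100) ^ (n + 1) ≤ (20 / 3) ^ S * (97 / 100) ^ n := by gcongr
      _ ≤ Real.exp (-1) := by linarith
  refine ⟨5 * (n + 1), fun j hj => ⟨(j + 1) ^ 2 * (5 / 3) ^ (j + 1), 1, one_pos, ?_⟩⟩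
  intro ι V _ Δ δ hconn hgirth hv hdiam i
  refine one_sub_le_labelingProb_subdivision (hgirth i) n.succ_pos hj ?_ hS
  have hd : (Δ i).diam ≤ ⌈C⌉₊ * δ i := by
    have : ((Δ i).diam : ℝ) ≤ ⌈C⌉₊ * δ i :=
      (hdiam i).trans (mul_le_mul_of_nonneg_right (Nat.le_ceil C) (Nat.cast_nonneg _))
    exact_mod_cast this
  refine (card_subdivVertex_le_two_pow (hconn i) (hv i) hd j).trans_eq ?_
  rw [mul_assoc (2 * (v + 1))]
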